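/- Let $K$ be a field and let $S=K[x_1,\dots,x_m,y_1,\dots,y_n]$ be bigraded by $\deg x_i=(1,0)$ and $\deg y_j=(0,1)$. Put $Q=(y_1,\dots,y_n)$ and let $M$ be a finitely generated bigraded ($\mathbb Z^2$-graded) $S$-module. For an $S$-module $N$ let $\operatorname{cd}(Q,N)$ be the largest integer $k$ for which the local cohomology module $H^k_Q(N)$ is nonzero ($-\infty$ if there is none, e.g. for $N=0$). Let $0=D_0\subsetneq D_1\subsetneq\dots\subsetneq D_r=M$ be the dimension filtration of $M$ with respect to $Q$; that is, all $D_i$ are bigraded submodules, and for $i=1,\dots,r$ the module $D_{i-1}$ is the largest bigraded submodule $N$ of $D_i$ with $\operatorname{cd}(Q,N)<\operatorname{cd}(Q,D_i)$. Let $$B_i=\{\mathfrak p\in\operatorname{Ass}(M):\operatorname{cd}(Q,S/\mathfrak p)\le\operatorname{cd}(Q,D_i)\},\qquad I_i=\prod_{\mathfrak p\in B_i}\mathfrak p ,$$ where an empty product is $S$. Let $0=\bigcap_{j=1}^s N_j$ be any reduced (i.e. minimal) primary decomposition of $0$ in $M$, with $N_j$ being $\mathfrak p_j$-primary. Then $$D_i=H^0_{I_i}(M)=\bigcap_{\mathfrak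 p_j\notin B_i}N_j\qquad\text{for all } 0\le i<r,$$ where $H^0_{I}(M)=\{x\in M: I^kx=0\text{ for some }k\ge 0\}$ and an empty intersection is $M$. -/

import Mathlib

universe u

noncomputable section

namespace BigradedCd

/-- The polynomial ring `K[x₁, …, xₘ, y₁, …, yₙ]`; `Sum.inl` indexes the `x`-variables and
`Sum.inr` the `y`-variables. -/
abbrev S (K : Type u) [Field K] (m n : ℕ) : Type u := MvPolynomial (Fin m ⊕ Fin n) K

/-- The bidegrees of the variables: `deg xᵢ = (1, 0)` and `deg yⱼ = (0, 1)`. -/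
def bidegree (m n : ℕ) : Fin m ⊕ Fin n → ℤ × ℤ :=
  Sum.elim (fun _ => (1, 0)) (fun _ => (0, 1))

/-- The standard bigrading of `S`: the component of bidegree `d` is spanned over `K` by the
monomials of bidegree `d`. -/
abbrev grading (K : Type u) [Field K] (m n : ℕ) : ℤ × ℤ → Submodule K (S K m n) :=
  MvPolynomial.weightedHomogeneousSubmodule K (bidegree m n)

/-- The irrelevant ideal `Q = (y₁, …, yₙ)`. -/
def Q (K : Type u) [Field K] (m n : ℕ) : Ideal (S K m n) :=
  Ideal.span (Set.range fun j : Fin n => MvPolynomial.X (Sum.inr j))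

/-- The cohomological dimension of `M` with respect to the ideal `J`: the largest `i` for which the
local cohomology module `Hⁱ_J(M)` is nonzero. It is `⊥` (that is, `-∞`) when there is no such `i`,
in particular when `M = 0`. -/
def cd {R : Type u} [CommRing R] (J : Ideal R) (M : Type u) [AddCommGroup M] [Module R M] :
    WithBot ℕ∞ :=
  sSup {c : WithBot ℕ∞ | ∃ i : ℕ, c = ((i : ℕ∞) : WithBot ℕ∞) ∧
    ¬ CategoryTheory.Limits.IsZero ((localCohomology J i).obj (ModuleCat.of R M))}

/-- The zeroth local cohomology `H⁰_I(M)`, as a submodule of `M`: the elements that are annihilated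
by some power of `I`. -/
def H0 {R : Type*} [CommRing R] (I : Ideal R) (M : Type*) [AddCommGroup M] [Module R M] :
    Submodule R M where
  carrier := {x | ∃ k : ℕ, ∀ a ∈ I ^ k, a • x = 0}
  zero_mem' := ⟨0, fun a _ => smul_zero a⟩
  add_mem' := by
    rintro x y ⟨k, hk⟩ ⟨l, hl⟩
    refine ⟨k + l, fun a ha => ?_⟩
    rw [smul_add, hk a (Ideal.pow_le_pow_right (Nat.le_add_right k l) ha),
      hl a (Ideal.pow_le_pow_right (Nat.le_add_left l k) ha), add_zero]
  smul_mem' := by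
    rintro c x ⟨k, hk⟩
    refine ⟨k, fun a ha => ?_⟩
    rw [smul_comm, hk a ha, smul_zero]

section Filtration

variable {K : Type u} [Field K] {m n : ℕ} {M : Type u} [AddCommGroup M] [Module (S K m n) M]

/-- `D₀ ⊊ D₁ ⊊ ⋯ ⊊ Dᵣ` is the dimension filtration of the bigraded module `M` (with homogeneous
components `ℳ`) with respect to `Q`: it is a strictly increasing filtration from `0` to `M` by
bigraded submodules, and `Dᵢ₋₁` is the largest bigraded submodule of `Dᵢ` whose cohomological
dimension with respect to `Q` is smaller than that of `Dᵢ`. -/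
structure IsDimensionFiltration (ℳ : ℤ × ℤ → AddSubgroup M) [DirectSum.Decomposition ℳ]
    {r : ℕ} (D : Fin (r + 1) → Submodule (S K m n) M) : Prop where
  zero_eq : D 0 = ⊥
  last_eq : D (Fin.last r) = ⊤
  strictMono : StrictMono D
  bigraded : ∀ i, (D i).IsHomogeneous ℳ
  largest : ∀ i : Fin r, IsGreatest
    {N : Submodule (S K m n) M |
      N.IsHomogeneous ℳ ∧ N ≤ D i.succ ∧ cd (Q K m n) N < cd (Q K m n) (D i.succ)}
    (D i.castSucc)

/-- `B_N`: the associated primes `𝔭` of `M` with `cd(Q, S/𝔭) ≤ cd(Q, N)`. -/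
def B (N : Submodule (S K m n) M) : Set (Ideal (S K m n)) :=
  {p | p ∈ associatedPrimes (S K m n) M ∧ cd (Q K m n) (S K m n ⧸ p) ≤ cd (Q K m n) N}

/-- `I_N`: the product of the primes in `B_N`. For a finitely generated module `M` this is a finite
product, since `M` has only finitely many associated primes; the empty product is `S`. -/
def I (N : Submodule (S K m n) M) : Ideal (S K m n) :=
  ∏ᶠ p ∈ B N, p

end Filtration

end BigradedCd

end

/-! For finitely generated `N`, the number cd(Q, N) is the maximum of cd(Q, S/q) over the primes q
in the support of N, so it depends only on the support and is monotone. One inequality comes from a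
prime filtration of N (`lcVanishes_of_forall_prime`). The other is `LCVanishes.quotient_prime`, a
descending induction on the cohomological degree. It can start because H^i_Q vanishes for i > n
(`lcVanishes_Q`).

Write D for D_i, B for B_i and I for I_i. If x ∈ D lies outside N_j, then ann(D) ⊆ p_j because N_j
is primary, so p_j is in the support of D and p_j ∈ B. Hence D ⊆ ⋂_{p_j ∉ B} N_j. This intersection
is H⁰_I(M), because B is closed under passing to larger associated primes.

For H⁰_I(M) ⊆ D, a power of I kills H⁰_I(M), so each prime in its support contains a member of B and
cd(Q, H⁰_I(M)) ≤ cd(Q, D). Associated primes of a bigraded module are bigraded, so H⁰_I(M) is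
bigraded too. Starting from D_r = M, the maximality of each D_j pushes H⁰_I(M) down the filtration
as far as D_i. -/

noncomputable section

namespace BigradedCd

/-! ### Local cohomology vanishing in terms of `Abelian.Ext`, where long exact sequences are at
hand. -/

section ExtComparison

open CategoryTheory Limits Opposite

variable {R : Type u} [CommRing R]

/-- The map induced by a chain map on the cochain complexes of morphisms to `Y`. -/
def linearYonedaMap {C D : ChainComplex (ModuleCat.{u} R) ℕ} (f : C ⟶ D) (Y : ModuleCat.{u} R) :
    D.linearYonedaObj R Y ⟶ C.linearYonedaObj R Y :=
  (HomologicalComplex.unopFunctor _ _).map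
    ((((linearYoneda R (ModuleCat.{u} R)).obj Y).rightOp.mapHomologicalComplex _).map f).op

theorem comp_eq_of_squares {C : Type*} [Category C] {A A' B B' D D' : C} {a : A ⟶ A'}
    {e' : A' ⟶ B'} {e : A ⟶ B} {b : B ⟶ B'} {f' : B' ⟶ D'} {f : B ⟶ D} {d : D ⟶ D'}
    (h₁ : a ≫ e' = e ≫ b) (h₂ : b ≫ f' = f ≫ d) : a ≫ e' ≫ f' = (e ≫ f) ≫ d := by
  rw [reassoc_of% h₁, h₂, Category.assoc]

theorem comp_inv_unop_eq {C : Type*} [Category C] {A A' : Cᵒᵖ} {B B' : C} (s : A ⟶ A')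
    (k : A' ≅ op B') (l : A ≅ op B) (t : B' ⟶ B) (h : s ≫ k.hom = l.hom ≫ t.op) :
    s.unop ≫ l.inv.unop = k.inv.unop ≫ t := by
  have : l.inv ≫ s = t.op ≫ k.inv := by rw [Iso.inv_comp_eq, ← Category.assoc, ← h]; simp
  exact congrArg Quiver.Hom.unop this

/-- `isoExt` is the left-derived-functor isomorphism followed by the comparison of homology with the
opposite complex. Each is natural in the resolution. -/
theorem isoExt_naturality {X X' : ModuleCat.{u} R} {P : ProjectiveResolution X}
    {P' : ProjectiveResolution X'} {g : X' ⟶ X} (φ : P'.Hom P g) (i : ℕ) (Y : ModuleCat.{u} R) :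
    ((Ext R (ModuleCat.{u} R) i).map g.op).app Y ≫ (P'.isoExt i Y).hom =
      (P.isoExt i Y).hom ≫ HomologicalComplex.homologyMap (linearYonedaMap φ.hom Y) i := by
  have h₁ := congrArg Quiver.Hom.unop
    (ProjectiveResolution.isoLeftDerivedObj_inv_naturality g P' P φ.hom
      (by simpa using φ.hom_f_zero_comp_π_f_zero) ((linearYoneda R _).obj Y).rightOp i)
  have h₂ := HomologicalComplex.homologyOp_hom_naturality (linearYonedaMap φ.hom Y) i
  exact comp_eq_of_squares h₁ (comp_inv_unop_eq _ _ _ _ h₂)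

theorem homologyπ_eq_zero_iff (K : CochainComplex (ModuleCat.{u} R) ℕ) (i : ℕ) (z : K.cycles i) :
    (K.homologyπ i).hom z = 0 ↔
      ∃ g, (K.d ((ComplexShape.up ℕ).prev i) i).hom g = (K.iCycles i).hom z := by
  have h := (ShortComplex.moduleCat_exact_iff
    (.mk _ _ (K.toCycles_comp_homologyπ ((ComplexShape.up ℕ).prev i) i))).1
    (ShortComplex.exact_of_g_is_cokernel _ (K.homologyIsCokernel _ i rfl))
  constructor
  · intro hz
    obtain ⟨g, hg⟩ := h z hz
    refine ⟨g, ?_⟩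
    rw [← hg, ← K.toCycles_i _ i]; rfl
  · rintro ⟨g, hg⟩
    have : (K.toCycles ((ComplexShape.up ℕ).prev i) i).hom g = z := by
      apply (ModuleCat.mono_iff_injective (K.iCycles i)).1 inferInstance
      rw [← hg, ← K.toCycles_i _ i]; rfl
    rw [← this, ← LinearMap.comp_apply, ← ModuleCat.hom_comp, K.toCycles_comp_homologyπ]; rfl

theorem exists_iCycles_eq (K : CochainComplex (ModuleCat.{u} R) ℕ) (i j : ℕ) (hj : i + 1 = j)
    (x : K.X i) (hx : (K.d i j).hom x = 0) : ∃ z, (K.iCycles i).hom z = x := by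
  have h := (ShortComplex.moduleCat_exact_iff (.mk _ _ (K.iCycles_d i j))).1
    (ShortComplex.exact_of_f_is_kernel _ (K.cyclesIsKernel i j (by simp [hj])))
  exact h x hx

variable {X Y : ModuleCat.{u} R} (P : ProjectiveResolution X)

theorem extMk_eq_zero_iff_exists (i : ℕ) (f : P.complex.X i ⟶ Y)
    (hf : P.complex.d (i+1) i ≫ f = 0) : P.extMk f (i+1) rfl hf = 0 ↔
      ∃ g, ((P.complex.linearYonedaObj R Y).d ((ComplexShape.up ℕ).prev i) i).hom g = f := by
  cases i with
  | succ i =>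
    rw [P.extMk_eq_zero_iff f _ rfl hf i rfl]
    have : (ComplexShape.up ℕ).prev (i+1) = i := by simp
    rw [this]
    rfl
  | zero =>
    simp only [← P.extEquivCohomologyClass.apply_eq_iff_eq,
      P.extEquivCohomologyClass_extMk, P.extEquivCohomologyClass_zero,
      CochainComplex.HomComplex.CohomologyClass.mk_eq_zero_iff]
    -- In degree 0 a coboundary would factor through the resolution in cohomological degree 1, which
    -- is zero. On the other side `prev 0 = 0` and that differential is zero as well, so both
    -- conditions say `f = 0`.
    rw [CochainComplex.HomComplex.Cocycle.toSingleMk_mem_coboundaries_iff _ _ _ _ _ 1 (by simp)]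
    have hz : IsZero (P.cochainComplex.X 1) := P.cochainComplex.isZero_of_isStrictlyLE 0 1 (by simp)
    constructor
    · rintro ⟨g, hg⟩
      refine ⟨0, ?_⟩
      rw [hz.eq_zero_of_src g, comp_zero] at hg
      rw [map_zero]
      exact ((cancel_epi _).1 (hg.symm.trans comp_zero.symm)).symm
    · rintro ⟨g, hg⟩
      refine ⟨0, ?_⟩
      have : ((P.complex.linearYonedaObj R Y).d ((ComplexShape.up ℕ).prev 0) 0) = 0 :=
        HomologicalComplex.shape _ _ _ (by simp)
      rw [this] at hg
      rw [← hg]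
      change _ = _ ≫ 0
      simp

/-- Two elements of the derived-functor `Ext` and of the derived-category `Ext` correspond
when they are represented by the same cocycle of a projective resolution. -/
def SameClass (P : ProjectiveResolution X) {i : ℕ}
    (x : ((_root_.Ext R (ModuleCat.{u} R) i).obj (op X)).obj Y) (e : Abelian.Ext X Y i) : Prop :=
  ∃ (z : (P.complex.linearYonedaObj R Y).cycles i) (f : P.complex.X i ⟶ Y)
    (hf : P.complex.d (i+1) i ≫ f = 0),
    ((P.complex.linearYonedaObj R Y).iCycles i).hom z = f ∧
    (P.isoExt i Y).hom.hom x = ((P.complex.linearYonedaObj R Y).homologyπ i).hom z ∧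
    e = P.extMk f (i+1) rfl hf

variable {P} {i : ℕ}

theorem SameClass.eq_zero_iff {x : ((_root_.Ext R (ModuleCat.{u} R) i).obj (op X)).obj Y}
    {e : Abelian.Ext X Y i} (h : SameClass P x e) : x = 0 ↔ e = 0 := by
  obtain ⟨z, f, hf, hz, hx, rfl⟩ := h
  rw [extMk_eq_zero_iff_exists, ← hz]
  refine Iff.trans ?_ (homologyπ_eq_zero_iff _ i z)
  rw [← hx]
  exact ((P.isoExt i Y).toLinearEquiv.map_eq_zero_iff (x := x)).symm

theorem SameClass.exists_right (P : ProjectiveResolution X)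
    (x : ((_root_.Ext R (ModuleCat.{u} R) i).obj (op X)).obj Y) : ∃ e, SameClass P x e := by
  have h := (ModuleCat.epi_iff_surjective ((P.complex.linearYonedaObj R Y).homologyπ i)).1
    inferInstance
  obtain ⟨z, hz⟩ := h ((P.isoExt i Y).hom.hom x)
  refine ⟨_, z, _, ?_, rfl, hz.symm, rfl⟩
  exact LinearMap.congr_fun
    (congrArg ModuleCat.Hom.hom ((P.complex.linearYonedaObj R Y).iCycles_d i (i+1))) z

theorem SameClass.exists_left (P : ProjectiveResolution X) (e : Abelian.Ext X Y i) :
    ∃ x : ((_root_.Ext R (ModuleCat.{u} R) i).obj (op X)).obj Y, SameClass P x e := by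
  obtain ⟨f, hf, rfl⟩ := P.extMk_surjective e (i+1) rfl
  obtain ⟨z, hz⟩ := exists_iCycles_eq (P.complex.linearYonedaObj R Y) i (i+1) rfl f hf
  obtain ⟨x, hx⟩ := (P.isoExt i Y).toLinearEquiv.surjective
    (((P.complex.linearYonedaObj R Y).homologyπ i).hom z)
  exact ⟨x, z, f, hf, hz, hx, rfl⟩

theorem SameClass.map {x : ((_root_.Ext R (ModuleCat.{u} R) i).obj (op X)).obj Y}
    {e : Abelian.Ext X Y i} (h : SameClass P x e)
    {X' : ModuleCat.{u} R} {P' : ProjectiveResolution X'} {g : X' ⟶ X} (φ : P'.Hom P g) :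
    SameClass P' ((((_root_.Ext R (ModuleCat.{u} R) i).map g.op).app Y).hom x)
      ((Abelian.Ext.mk₀ g).comp e (zero_add _)) := by
  obtain ⟨z, f, hf, hz, hx, rfl⟩ := h
  refine ⟨(HomologicalComplex.cyclesMap (linearYonedaMap φ.hom Y) i).hom z, _, _, ?_, ?_,
    ProjectiveResolution.mk₀_comp_extMk f _ rfl hf φ⟩
  · refine Eq.trans ?_ (congrArg ((linearYonedaMap φ.hom Y).f i).hom hz)
    exact LinearMap.congr_fun (congrArg ModuleCat.Hom.hom
      (HomologicalComplex.cyclesMap_i (linearYonedaMap φ.hom Y) i)) z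
  · refine (LinearMap.congr_fun (congrArg ModuleCat.Hom.hom (isoExt_naturality φ i Y)) x).trans ?_
    refine (congrArg _ hx).trans ?_
    exact LinearMap.congr_fun (congrArg ModuleCat.Hom.hom
      (HomologicalComplex.homologyπ_naturality (linearYonedaMap φ.hom Y) i)) z

theorem sameClass_precomp_eq_zero_iff {X X' Y : ModuleCat.{u} R} {P : ProjectiveResolution X}
    {i : ℕ} {x : ((_root_.Ext R (ModuleCat.{u} R) i).obj (op X)).obj Y} {e : Abelian.Ext X Y i}
    (h : SameClass P x e) (g : X' ⟶ X) :
    (((_root_.Ext R (ModuleCat.{u} R) i).map g.op).app Y).hom x = 0 ↔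
      (Abelian.Ext.mk₀ g).comp e (zero_add _) = 0 := by
  let P' := projectiveResolution X'
  let φ : P'.Hom P g := ⟨ProjectiveResolution.lift g P' P, by
    simpa using ProjectiveResolution.lift_commutes_zero g P' P⟩
  exact (h.map φ).eq_zero_iff

/-- The canonical map `R ⧸ J ^ l → R ⧸ J ^ k` for `k ≤ l`. -/
def powQuotMap (J : Ideal R) {k l : ℕ} (h : k ≤ l) :
    ModuleCat.of R (R ⧸ J ^ l) ⟶ ModuleCat.of R (R ⧸ J ^ k) :=
  ModuleCat.ofHom (Submodule.mapQ _ _ LinearMap.id (Ideal.pow_le_pow_right h))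

/-- Local cohomology is the filtered colimit of Ext^i(R/J^k, Y), and such a colimit is zero exactly
when every element dies at a later stage. -/
theorem isZero_localCohomology_iff (J : Ideal R) (i : ℕ) (Y : ModuleCat.{u} R) :
    IsZero ((localCohomology J i).obj Y) ↔
      ∀ (k : ℕ) (e : Abelian.Ext (ModuleCat.of R (R ⧸ J ^ k)) Y i), ∃ (l : ℕ) (h : k ≤ l),
        (Abelian.Ext.mk₀ (powQuotMap J h)).comp e (zero_add _) = 0 := by
  let F := localCohomology.diagram (localCohomology.idealPowersDiagram J) i
  let G := F ⋙ (evaluation _ _).obj Y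
  let iso : (localCohomology J i).obj Y ≅ colimit G := colimitObjIsoColimitCompEvaluation F Y
  rw [iso.isZero_iff]
  have : PreservesFilteredColimitsOfSize.{0, 0} (forget (ModuleCat.{u} R)) :=
    preservesFilteredColimitsOfSize_shrink.{0, u, 0, u} _
  have : PreservesColimitsOfShape ℕᵒᵖᵒᵖ (forget (ModuleCat.{u} R)) :=
    PreservesFilteredColimitsOfSize.preserves_filtered_colimits _
  constructor
  · intro hz k e
    let P := projectiveResolution (ModuleCat.of R (R ⧸ J ^ k))
    obtain ⟨x, hx⟩ := SameClass.exists_left P e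
    have := ModuleCat.subsingleton_of_isZero hz
    obtain ⟨l, f, hl⟩ := Concrete.colimit_rep_eq_zero R G (op (op k)) x (Subsingleton.elim _ _)
    have hkl : k ≤ l.unop.unop := leOfHom f.unop.unop
    refine ⟨l.unop.unop, hkl, ?_⟩
    exact (sameClass_precomp_eq_zero_iff hx (powQuotMap J hkl)).1 hl
  · intro H
    refine @ModuleCat.isZero_of_subsingleton _ _ _ ⟨fun a b => ?_⟩
    suffices h : ∀ a : (colimit G : ModuleCat R), a = 0 by rw [h a, h b]
    intro a
    obtain ⟨k, x, rfl⟩ := Concrete.colimit_exists_rep G a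
    let P := projectiveResolution (ModuleCat.of R (R ⧸ J ^ k.unop.unop))
    obtain ⟨e, hx⟩ := SameClass.exists_right P x
    obtain ⟨l, hl, he⟩ := H _ e
    have h0 := (sameClass_precomp_eq_zero_iff hx (powQuotMap J hl)).2 he
    let f : k ⟶ op (op l) := (homOfLE hl).op.op
    rw [← colimit.w G f]
    refine (congrArg (colimit.ι G (op (op l))).hom h0).trans (map_zero _)

end ExtComparison

/-! ### Local cohomology vanishing in short exact sequences. -/

section LocalCohomologyVanishing

open CategoryTheory Limits

variable {R : Type u} [CommRing R]

/-- The vanishing of the local cohomology module `Hⁱ_J(M)`. -/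
def LCVanishes (J : Ideal R) (i : ℕ) (M : Type u) [AddCommGroup M] [Module R M] : Prop :=
  IsZero ((localCohomology J i).obj (ModuleCat.of R M))

variable {J : Ideal R} {i : ℕ} {A B C : Type u} [AddCommGroup A] [Module R A] [AddCommGroup B]
  [Module R B] [AddCommGroup C] [Module R C]

theorem mk₀_powQuotMap_comp {Y : ModuleCat.{u} R} {k l l' : ℕ} (h : k ≤ l) (h' : l ≤ l')
    (e : Abelian.Ext (ModuleCat.of R (R ⧸ J ^ k)) Y i) :
    (Abelian.Ext.mk₀ (powQuotMap J (h.trans h'))).comp e (zero_add _) =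
      (Abelian.Ext.mk₀ (powQuotMap J h')).comp
        ((Abelian.Ext.mk₀ (powQuotMap J h)).comp e (zero_add _)) (zero_add _) := by
  rw [Abelian.Ext.mk₀_comp_mk₀_assoc]
  congr 2
  ext
  rfl

/-- The short exact sequence in `ModuleCat` given by an exact pair of linear maps. -/
def shortComplexOfExact (f : A →ₗ[R] B) (g : B →ₗ[R] C) (h : Function.Exact f g) :
    ShortComplex (ModuleCat.{u} R) :=
  ModuleCat.shortComplexOfCompEqZero f g h.linearMap_comp_eq_zero

theorem shortExact_shortComplexOfExact {f : A →ₗ[R] B} {g : B →ₗ[R] C}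
    (hf : Function.Injective f) (hg : Function.Surjective g) (h : Function.Exact f g) :
    (shortComplexOfExact f g h).ShortExact where
  exact := ModuleCat.shortComplex_exact _ h
  mono_f := (ModuleCat.mono_iff_injective _).2 hf
  epi_g := (ModuleCat.epi_iff_surjective _).2 hg

/-- Restricting a class to R/J^l kills its image in `T.X₃`, so it lifts to `T.X₁`. Restricting
further kills the lift. -/
theorem isZero_localCohomology_X₂ {T : ShortComplex (ModuleCat.{u} R)} (hT : T.ShortExact)
    (h₁ : IsZero ((localCohomology J i).obj T.X₁)) (h₃ : IsZero ((localCohomology J i).obj T.X₃)) :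
    IsZero ((localCohomology J i).obj T.X₂) := by
  refine (isZero_localCohomology_iff J i _).2 fun k e => ?_
  obtain ⟨l, hl, he⟩ := (isZero_localCohomology_iff J i _).1 h₃ k
    (e.comp (Abelian.Ext.mk₀ T.g) (add_zero i))
  rw [← Abelian.Ext.comp_assoc (h₁₂ := zero_add i) (h₂₃ := add_zero i) (h := by simp)] at he
  obtain ⟨x, hx⟩ := Abelian.Ext.covariant_sequence_exact₂ _ hT _ he
  obtain ⟨l', hl', hx'⟩ := (isZero_localCohomology_iff J i _).1 h₁ l x
  refine ⟨l', hl.trans hl', ?_⟩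
  rw [mk₀_powQuotMap_comp hl hl', ← hx,
    ← Abelian.Ext.comp_assoc (h₁₂ := zero_add i) (h₂₃ := add_zero i) (h := by simp),
    hx', Abelian.Ext.zero_comp]

theorem isZero_localCohomology_X₃ {T : ShortComplex (ModuleCat.{u} R)} (hT : T.ShortExact)
    (h₂ : IsZero ((localCohomology J i).obj T.X₂))
    (h₁ : IsZero ((localCohomology J (i + 1)).obj T.X₁)) :
    IsZero ((localCohomology J i).obj T.X₃) := by
  refine (isZero_localCohomology_iff J i _).2 fun k e => ?_
  obtain ⟨l, hl, he⟩ := (isZero_localCohomology_iff J (i + 1) _).1 h₁ k (e.comp hT.extClass rfl)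
  rw [← Abelian.Ext.comp_assoc (h₁₂ := zero_add i) (h₂₃ := rfl) (h := by simp)] at he
  obtain ⟨x, hx⟩ := Abelian.Ext.covariant_sequence_exact₃ _ hT _ rfl he
  obtain ⟨l', hl', hx'⟩ := (isZero_localCohomology_iff J i _).1 h₂ l x
  refine ⟨l', hl.trans hl', ?_⟩
  rw [mk₀_powQuotMap_comp hl hl', ← hx,
    ← Abelian.Ext.comp_assoc (h₁₂ := zero_add i) (h₂₃ := add_zero i) (h := by simp),
    hx', Abelian.Ext.zero_comp]

theorem LCVanishes.middle {f : A →ₗ[R] B} {g : B →ₗ[R] C}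
    (hf : Function.Injective f) (hg : Function.Surjective g) (h : Function.Exact f g)
    (hA : LCVanishes J i A) (hC : LCVanishes J i C) : LCVanishes J i B :=
  isZero_localCohomology_X₂ (shortExact_shortComplexOfExact hf hg h) hA hC

theorem LCVanishes.right {f : A →ₗ[R] B} {g : B →ₗ[R] C}
    (hf : Function.Injective f) (hg : Function.Surjective g) (h : Function.Exact f g)
    (hB : LCVanishes J i B) (hA : LCVanishes J (i + 1) A) : LCVanishes J i C :=
  isZero_localCohomology_X₃ (shortExact_shortComplexOfExact hf hg h) hB hA

theorem LCVanishes.of_equiv (e : A ≃ₗ[R] B) (hA : LCVanishes J i A) : LCVanishes J i B :=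
  hA.of_iso ((localCohomology J i).mapIso e.toModuleIso).symm

theorem lcVanishes_of_subsingleton [Subsingleton A] : LCVanishes J i A := by
  refine (isZero_localCohomology_iff J i _).2 fun k e => ⟨k, le_rfl, ?_⟩
  have : e = 0 := by
    rw [← Abelian.Ext.comp_mk₀_id e,
      (ModuleCat.isZero_of_subsingleton (ModuleCat.of R A)).eq_of_src (𝟙 _) 0,
      Abelian.Ext.mk₀_zero, Abelian.Ext.comp_zero]
  rw [this, Abelian.Ext.comp_zero]

/-- The ideals I are cofinal with the powers of J, so some transition map R/J^l → R/J^k factors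
through R/I, whose Ext^i is zero. -/
theorem lcVanishes_of_hasProjectiveDimensionLT {d : ℕ} (hd : d ≤ i)
    (hJ : ∀ k, ∃ (I : Ideal R) (l : ℕ), J ^ l ≤ I ∧ I ≤ J ^ k ∧
      HasProjectiveDimensionLT (ModuleCat.of R (R ⧸ I)) d) : LCVanishes J i A := by
  refine (isZero_localCohomology_iff J i _).2 fun k e => ?_
  obtain ⟨I, l, hl, hk, hI⟩ := hJ k
  have hl' : J ^ max k l ≤ I := (Ideal.pow_le_pow_right (le_max_right _ _)).trans hl
  let a : ModuleCat.of R (R ⧸ J ^ max k l) ⟶ ModuleCat.of R (R ⧸ I) :=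
    ModuleCat.ofHom (Submodule.mapQ _ _ LinearMap.id hl')
  let b : ModuleCat.of R (R ⧸ I) ⟶ ModuleCat.of R (R ⧸ J ^ k) :=
    ModuleCat.ofHom (Submodule.mapQ _ _ LinearMap.id hk)
  refine ⟨max k l, le_max_left _ _, ?_⟩
  have : powQuotMap J (le_max_left k l) = a ≫ b := by ext; rfl
  rw [this, ← Abelian.Ext.mk₀_comp_mk₀_assoc,
    Abelian.Ext.eq_zero_of_hasProjectiveDimensionLT ((Abelian.Ext.mk₀ b).comp e (zero_add _)) d hd,
    Abelian.Ext.comp_zero]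

end LocalCohomologyVanishing

/-! ### Vanishing of H^i_Q for i > n. -/

section PolynomialRing

open CategoryTheory MvPolynomial

variable {K : Type u} [Field K]

/-- Membership in a monomial ideal is tested on exponents, and multiplying by `X a ^ k` leaves the
exponents of the variables in `s` unchanged. Thus the powers `X b ^ k` form a regular sequence. -/
theorem mem_span_X_pow_of_X_pow_mul_mem {τ : Type*} {k : ℕ} {s : Finset τ} {a : τ} (ha : a ∉ s)
    {f : MvPolynomial τ K}
    (h : X a ^ k * f ∈ Ideal.span ((fun b : τ => (X b ^ k : MvPolynomial τ K)) '' s)) :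
    f ∈ Ideal.span ((fun b : τ => (X b ^ k : MvPolynomial τ K)) '' s) := by
  have himg : (fun b : τ => (X b ^ k : MvPolynomial τ K)) '' s =
      (fun v => monomial v (1 : K)) '' ((fun b => Finsupp.single b k) '' s) := by
    rw [Set.image_image]
    simp [X_pow_eq_monomial]
  rw [himg, mem_ideal_span_monomial_image] at h ⊢
  intro v hv
  obtain ⟨_, ⟨b, hb, rfl⟩, hbv⟩ := h (Finsupp.single a k + v) (by
    rw [mem_support_iff, X_pow_eq_monomial, coeff_monomial_mul, one_mul]
    exact mem_support_iff.1 hv)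
  refine ⟨_, ⟨b, hb, rfl⟩, ?_⟩
  have hab : a ≠ b := fun h => ha (h ▸ hb)
  rw [Finsupp.single_le_iff] at hbv ⊢
  simpa [Finsupp.single_apply, hab] using hbv

theorem hasProjectiveDimensionLT_quotient_sup_span_singleton {R : Type u} [CommRing R]
    {I : Ideal R} {x : R} (hx : ∀ f, x * f ∈ I → f ∈ I) {d : ℕ}
    (hI : HasProjectiveDimensionLT (ModuleCat.of R (R ⧸ I)) d) :
    HasProjectiveDimensionLT (ModuleCat.of R (R ⧸ (Ideal.span {x} ⊔ I))) (d + 1) := by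
  let f : R ⧸ I →ₗ[R] R ⧸ I := LinearMap.lsmul R _ x
  let g : R ⧸ I →ₗ[R] R ⧸ (Ideal.span {x} ⊔ I) := Submodule.mapQ _ _ LinearMap.id le_sup_right
  have hf : Function.Injective f := by
    rw [injective_iff_map_eq_zero]
    intro y hy
    obtain ⟨y, rfl⟩ := Ideal.Quotient.mk_surjective y
    exact Ideal.Quotient.eq_zero_iff_mem.2 (hx y (Ideal.Quotient.eq_zero_iff_mem.1 hy))
  have hg : Function.Surjective g := by
    intro y
    obtain ⟨y, rfl⟩ := Ideal.Quotient.mk_surjective y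
    exact ⟨Ideal.Quotient.mk _ y, rfl⟩
  have hfg : Function.Exact f g := by
    intro y
    obtain ⟨y, rfl⟩ := Ideal.Quotient.mk_surjective y
    constructor
    · intro hy
      have hy' : y ∈ Ideal.span {x} ⊔ I := Ideal.Quotient.eq_zero_iff_mem.1 hy
      obtain ⟨c, b, hb, rfl⟩ := Ideal.mem_span_singleton_sup.1 hy'
      refine ⟨Ideal.Quotient.mk _ c, ?_⟩
      refine Ideal.Quotient.eq.2 ?_
      have : x * c - (c * x + b) = -b := by ring
      exact this ▸ I.neg_mem hb
    · rintro ⟨c, hc⟩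
      obtain ⟨c, rfl⟩ := Ideal.Quotient.mk_surjective c
      rw [← hc]
      refine Ideal.Quotient.eq_zero_iff_mem.2 (Ideal.mem_sup_left ?_)
      exact Ideal.mul_mem_right _ _ (Ideal.mem_span_singleton_self x)
  have hI' : HasProjectiveDimensionLT (ModuleCat.of R (R ⧸ I)) (d + 1) :=
    hasProjectiveDimensionLT_of_ge _ d _ (Nat.le_succ d)
  exact (shortExact_shortComplexOfExact hf hg hfg).hasProjectiveDimensionLT_X₃ d hI hI'

theorem hasProjectiveDimensionLT_quotient_span_X_pow {τ : Type} {k : ℕ} (s : Finset τ) :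
    HasProjectiveDimensionLT (ModuleCat.of (MvPolynomial τ K) (MvPolynomial τ K ⧸
      Ideal.span ((fun b : τ => (X b ^ k : MvPolynomial τ K)) '' s))) (s.card + 1) := by
  classical
  induction s using Finset.induction_on with
  | empty =>
    rw [Finset.coe_empty, Set.image_empty, Ideal.span_empty]
    have : Projective (ModuleCat.of (MvPolynomial τ K)
        (MvPolynomial τ K ⧸ (⊥ : Ideal (MvPolynomial τ K)))) := by
      have : Module.Projective (MvPolynomial τ K)
          (MvPolynomial τ K ⧸ (⊥ : Ideal (MvPolynomial τ K))) :=
        Module.Projective.of_equiv (Submodule.quotEquivOfEqBot _ rfl).symm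
      infer_instance
    infer_instance
  | insert a s ha ih =>
    rw [Finset.coe_insert, Set.image_insert_eq, Ideal.span_insert, Finset.card_insert_of_notMem ha]
    exact hasProjectiveDimensionLT_quotient_sup_span_singleton
      (fun f hf => mem_span_X_pow_of_X_pow_mul_mem ha hf) ih

theorem lcVanishes_Q {m n i : ℕ} (hi : n < i) (A : Type u) [AddCommGroup A] [Module (S K m n) A] :
    LCVanishes (Q K m n) i A := by
  classical
  refine lcVanishes_of_hasProjectiveDimensionLT (d := n + 1) hi fun k => ?_
  let s : Finset (Fin m ⊕ Fin n) := Finset.univ.image Sum.inr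
  have hs : s.card = n := by
    rw [Finset.card_image_of_injective _ Sum.inr_injective, Finset.card_univ, Fintype.card_fin]
  let I : Ideal (S K m n) := Ideal.span ((fun b => (X b ^ k : S K m n)) '' s)
  have hrad : Q K m n ≤ I.radical := by
    rw [Q, Ideal.span_le]
    rintro _ ⟨j, rfl⟩
    exact ⟨k, Ideal.subset_span ⟨Sum.inr j, by simp [s], rfl⟩⟩
  obtain ⟨l, hl⟩ := Ideal.exists_pow_le_of_le_radical_of_fg hrad (IsNoetherian.noetherian _)
  refine ⟨I, l, hl, ?_, ?_⟩
  swap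
  · have := hasProjectiveDimensionLT_quotient_span_X_pow (K := K) (k := k) s
    rwa [hs] at this
  rw [Ideal.span_le]
  rintro _ ⟨b, hb, rfl⟩
  obtain ⟨j, -, rfl⟩ := Finset.mem_image.1 hb
  have hX : X (Sum.inr j) ∈ Q K m n := Ideal.subset_span ⟨j, rfl⟩
  exact Ideal.pow_mem_pow hX k

end PolynomialRing

/-! ### Local cohomology vanishing and the support. -/

section Support

variable {R : Type u} [CommRing R] {J : Ideal R}

theorem lcVanishes_of_forall_prime [IsNoetherianRing R] {i : ℕ} {N : Type u} [AddCommGroup N]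
    [Module R N] [hN : Module.Finite R N]
    (h : ∀ q : Ideal R, q.IsPrime → Module.annihilator R N ≤ q → LCVanishes J i (R ⧸ q)) :
    LCVanishes J i N := by
  revert h
  refine IsNoetherianRing.induction_on_isQuotientEquivQuotientPrime R hN
    (motive := fun N _ _ _ => (∀ q : Ideal R, q.IsPrime → Module.annihilator R N ≤ q →
      LCVanishes J i (R ⧸ q)) → LCVanishes J i N) ?_ ?_ ?_
  · intro N _ _ _ _ _
    exact lcVanishes_of_subsingleton
  · intro N _ _ _ p e h
    refine (h p.1 p.2 ?_).of_equiv e.symm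
    rw [e.annihilator_eq, Ideal.annihilator_quotient]
  · intro N₁ _ _ _ N₂ _ _ _ N₃ _ _ _ f g hf hg hfg h₁ h₃ h
    exact LCVanishes.middle hf hg hfg
      (h₁ fun q hq hle => h q hq ((f.annihilator_le_of_injective hf).trans hle))
      (h₃ fun q hq hle => h q hq ((g.annihilator_le_of_surjective hg).trans hle))

/-- By Nakayama the fibre of M at q is nonzero. A functional on it gives a nonzero map from M to the
residue field, and clearing the denominators of the finitely many generators lands it in R/q. -/
theorem exists_ne_zero_hom_quotient_prime {M : Type u} [AddCommGroup M] [Module R M]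
    [Module.Finite R M] {q : Ideal R} [hq : q.IsPrime] (h : Module.annihilator R M ≤ q) :
    ∃ φ : M →ₗ[R] R ⧸ q, φ ≠ 0 := by
  classical
  have hsupp : (⟨q, hq⟩ : PrimeSpectrum R) ∈ Module.support R M :=
    Module.mem_support_iff_of_finite.2 h
  have hnt : Nontrivial (TensorProduct R q.ResidueField M) :=
    (Module.mem_support_iff_nontrivial_residueField_tensorProduct (⟨q, hq⟩ : PrimeSpectrum R)).1
      hsupp
  obtain ⟨v, hv⟩ := exists_ne (0 : TensorProduct R q.ResidueField M)
  obtain ⟨ψ, hψ⟩ : ∃ ψ : Module.Dual q.ResidueField (TensorProduct R q.ResidueField M),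
      ψ v ≠ 0 := by
    by_contra! hc
    exact hv ((Module.forall_dual_apply_eq_zero_iff q.ResidueField v).1 hc)
  let g : M →ₗ[R] q.ResidueField :=
    (ψ.restrictScalars R).comp (TensorProduct.mk R q.ResidueField M 1)
  obtain ⟨m, hm⟩ : ∃ m, g m ≠ 0 := by
    by_contra! hc
    apply hψ
    have h0 : ψ = 0 := by
      ext m
      exact hc m
    rw [h0, LinearMap.zero_apply]
  obtain ⟨s, hs⟩ := Module.Finite.fg_top (R := R) (M := M)
  obtain ⟨b, hb⟩ := IsLocalization.exist_integer_multiples_of_finset (nonZeroDivisors (R ⧸ q))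
    (s.image g)
  obtain ⟨b', hb'⟩ := Ideal.Quotient.mk_surjective (b : R ⧸ q)
  let ι : R ⧸ q →ₗ[R] q.ResidueField :=
    (IsScalarTower.toAlgHom R (R ⧸ q) q.ResidueField).toLinearMap
  have hι : Function.Injective ι := IsFractionRing.injective (R ⧸ q) q.ResidueField
  have hsmul : ∀ x : q.ResidueField, b' • x = (b : R ⧸ q) • x := by
    intro x
    rw [← hb', Algebra.smul_def, Algebra.smul_def]
    rfl
  have hrange : ∀ x, (b' • g) x ∈ LinearMap.range ι := by
    intro x
    have hx : x ∈ Submodule.span R (s : Set M) := hs ▸ Submodule.mem_top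
    refine Submodule.span_le (p := (LinearMap.range ι).comap (b' • g)) |>.2 ?_ hx
    intro y hy
    obtain ⟨z, hz⟩ := hb (g y) (Finset.mem_image_of_mem g hy)
    refine ⟨z, ?_⟩
    rw [LinearMap.smul_apply, hsmul]
    exact hz
  let e := LinearEquiv.ofInjective ι hι
  refine ⟨e.symm.toLinearMap.comp ((b' • g).codRestrict _ hrange), fun h0 => ?_⟩
  have h1 := LinearMap.congr_fun h0 m
  rw [LinearMap.comp_apply, LinearMap.zero_apply, LinearEquiv.coe_coe,
    map_eq_zero_iff _ e.symm.injective] at h1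
  have h2 : b' • g m = 0 := congrArg Subtype.val h1
  rw [hsmul, Algebra.smul_def, mul_eq_zero] at h2
  refine h2.elim (fun h3 => ?_) hm
  exact nonZeroDivisors.coe_ne_zero b
    ((IsFractionRing.injective (R ⧸ q) q.ResidueField) (h3.trans (map_zero _).symm))

/-- If the local cohomology of a finite module `M` vanishes from degree `c` on, then so does the
local cohomology of `R ⧸ q` for every prime `q` in the support of `M`. -/
theorem LCVanishes.quotient_prime [IsNoetherianRing R] {M : Type u} [AddCommGroup M] [Module R M]
    [Module.Finite R M] {c d : ℕ}
    (hd : ∀ i, d < i → ∀ (N : Type u) [AddCommGroup N] [Module R N], LCVanishes J i N)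
    (hM : ∀ i, c ≤ i → LCVanishes J i M) {q : Ideal R} (hq : q.IsPrime)
    (hMq : Module.annihilator R M ≤ q) {i : ℕ} (hi : c ≤ i) : LCVanishes J i (R ⧸ q) := by
  -- Descending induction on `i`, started above `d`. Within each degree, Noetherian induction on `q`
  -- assumes the claim for strictly larger primes.
  obtain ⟨t, ht⟩ : ∃ t, d < i + t := ⟨d + 1, by lia⟩
  induction t generalizing i q with
  | zero => exact hd i ht _
  | succ t ih =>
    have ih' (N : Type u) [AddCommGroup N] [Module R N] [Module.Finite R N]
        (hN : Module.annihilator R M ≤ Module.annihilator R N) : LCVanishes J (i + 1) N :=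
      lcVanishes_of_forall_prime fun p hp hle => ih hp (hN.trans hle) (by lia) (by lia)
    induction q using IsNoetherian.induction with
    | hgt q ihq =>
    obtain ⟨φ, hφ⟩ := exists_ne_zero_hom_quotient_prime hMq
    -- The image of φ is a quotient of M whose kernel has no cohomology in degree i + 1, by the
    -- outer induction.
    have hrange : LCVanishes J i (LinearMap.range φ) := by
      refine LCVanishes.right (f := (LinearMap.ker φ).subtype) (g := φ.rangeRestrict)
        (Submodule.injective_subtype _) φ.surjective_rangeRestrict ?_ (hM i hi)
        (ih' _ (LinearMap.annihilator_le_of_injective _ (Submodule.injective_subtype _)))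
      rw [LinearMap.exact_iff, Submodule.range_subtype, LinearMap.ker_rangeRestrict]
    obtain ⟨x, hx⟩ : ∃ x, φ x ≠ 0 := by
      by_contra! hc
      exact hφ (LinearMap.ext hc)
    obtain ⟨y, hy⟩ := Ideal.Quotient.mk_surjective (φ x)
    have hyq : y ∉ q := fun h => hx (hy ▸ Ideal.Quotient.eq_zero_iff_mem.2 h)
    refine LCVanishes.middle (f := (LinearMap.range φ).subtype) (g := (LinearMap.range φ).mkQ)
      (Submodule.injective_subtype _) (Submodule.mkQ_surjective _) ?_ hrange
      (lcVanishes_of_forall_prime fun p hp hle => ?_)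
    · exact LinearMap.exact_subtype_mkQ _
    · have hqp : q ≤ p := by
        refine le_trans ?_ hle
        refine le_trans ?_ ((LinearMap.range φ).mkQ.annihilator_le_of_surjective
          (Submodule.mkQ_surjective _))
        rw [Ideal.annihilator_quotient]
      -- The element `y` kills the cokernel of φ, since y·w is the class of φ(w • x). Hence the
      -- primes in the support of the cokernel are strictly larger than `q`.
      have hyp : y ∈ p := by
        refine hle (Module.mem_annihilator.2 fun w => ?_)
        obtain ⟨w, rfl⟩ := Submodule.mkQ_surjective _ w
        obtain ⟨w, rfl⟩ := Ideal.Quotient.mk_surjective w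
        rw [← map_smul, Submodule.mkQ_apply, Submodule.Quotient.mk_eq_zero]
        refine ⟨w • x, ?_⟩
        rw [map_smul, ← hy]
        change Ideal.Quotient.mk q (w * y) = Ideal.Quotient.mk q (y * w)
        rw [mul_comm]
      exact ihq p (lt_of_le_of_ne hqp fun h => hyq (h ▸ hyp)) hp (hMq.trans hqp)

end Support

/-! ### Cohomological dimension is determined by the support. -/

section CohomologicalDimension

theorem cd_le_iff {R : Type u} [CommRing R] {J : Ideal R} {M : Type u} [AddCommGroup M]
    [Module R M] {b : WithBot ℕ∞} :
    cd J M ≤ b ↔ ∀ i : ℕ, ¬ LCVanishes J i M → ((i : ℕ∞) : WithBot ℕ∞) ≤ b := by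
  rw [cd, sSup_le_iff]
  constructor
  · intro h i hi
    exact h _ ⟨i, rfl, hi⟩
  · rintro h _ ⟨i, rfl, hi⟩
    exact h i hi

variable {K : Type u} [Field K] {m n : ℕ} {M : Type u} [AddCommGroup M] [Module (S K m n) M]
  [Module.Finite (S K m n) M]

theorem cd_quotient_prime_le {q : Ideal (S K m n)} (hq : q.IsPrime)
    (h : Module.annihilator (S K m n) M ≤ q) :
    cd (Q K m n) (S K m n ⧸ q) ≤ cd (Q K m n) M := by
  rw [cd_le_iff]
  intro i hi
  by_contra! hlt
  refine hi (LCVanishes.quotient_prime (M := M) (c := i) (d := n)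
    (fun i hi N _ _ => lcVanishes_Q hi N) (fun j hj => ?_) hq h le_rfl)
  by_contra hc
  have h1 : ((j : ℕ∞) : WithBot ℕ∞) ≤ cd (Q K m n) M := cd_le_iff.1 le_rfl j hc
  have h2 : ((i : ℕ∞) : WithBot ℕ∞) ≤ ((j : ℕ∞) : WithBot ℕ∞) := by exact_mod_cast hj
  exact absurd (hlt.trans_le h2) h1.not_gt

theorem cd_le_of_forall_prime {b : WithBot ℕ∞}
    (h : ∀ q : Ideal (S K m n), q.IsPrime → Module.annihilator (S K m n) M ≤ q →
      cd (Q K m n) (S K m n ⧸ q) ≤ b) : cd (Q K m n) M ≤ b := by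
  rw [cd_le_iff]
  intro i hi
  by_contra hb
  refine hi (lcVanishes_of_forall_prime fun q hq hle => ?_)
  by_contra hc
  exact hb (cd_le_iff.1 (h q hq hle) i hc)

theorem cd_quotient_anti {p q : Ideal (S K m n)} (hq : q.IsPrime) (h : p ≤ q) :
    cd (Q K m n) (S K m n ⧸ q) ≤ cd (Q K m n) (S K m n ⧸ p) :=
  cd_quotient_prime_le hq (by rwa [Ideal.annihilator_quotient])

theorem cd_mono {N N' : Submodule (S K m n) M} (h : N ≤ N') :
    cd (Q K m n) N ≤ cd (Q K m n) N' :=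
  cd_le_of_forall_prime fun _ hq hle => cd_quotient_prime_le hq
    (((Submodule.inclusion h).annihilator_le_of_injective
      (Submodule.inclusion_injective h)).trans hle)

end CohomologicalDimension

/-! ### Homogeneity of associated primes and of H⁰_I(M). -/

section Homogeneous

open DirectSum

variable {A : Type*} [CommRing A] {σ : Type*} [SetLike σ A]
  {𝒜 : ℤ × ℤ → σ} {M : Type*} [AddCommGroup M] [Module A M]

theorem decompose_smul_of_mem (ℳ : ℤ × ℤ → AddSubgroup M) [Decomposition ℳ]
    [SetLike.GradedSMul 𝒜 ℳ]
    {a : A} {e : ℤ × ℤ} (ha : a ∈ 𝒜 e) (x : M) (d : ℤ × ℤ) :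
    (decompose ℳ (a • x) (e + d) : M) = a • (decompose ℳ x d : M) := by
  induction x using Decomposition.inductionOn ℳ with
  | zero => simp
  | @homogeneous i y =>
    have hy : a • (y : M) ∈ ℳ (e + i) := SetLike.GradedSMul.smul_mem ha y.2
    by_cases h : i = d
    · subst h
      rw [decompose_of_mem_same ℳ hy, decompose_coe, of_eq_same]
    · rw [decompose_of_mem_ne ℳ hy (fun h' => h (add_left_cancel h')), decompose_coe,
        of_eq_of_ne _ _ _ (Ne.symm h)]
      simp
  | add y z hy hz =>
    rw [smul_add, decompose_add, decompose_add, DirectSum.add_apply, DirectSum.add_apply, AddMemClass.coe_add,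
      AddMemClass.coe_add, hy, hz, smul_add]

variable [AddSubgroupClass σ A] [GradedRing 𝒜]

/-- Order ℤ² lexicographically. The top component of a kills the top component of x, so multiplying
x by it leaves fewer components, and a still kills the product. Induct on the number of components.
-/
theorem exists_top_component_pow_smul_eq_zero (ℳ : ℤ × ℤ → AddSubgroup M) [Decomposition ℳ]
    [SetLike.GradedSMul 𝒜 ℳ]
    {a : A} {e : ℤ × ℤ}
    (he : ∀ e', decompose 𝒜 a e' ≠ 0 → toLex e' ≤ toLex e) (x : M) (hx : a • x = 0) :
    ∃ N : ℕ, (decompose 𝒜 a e : A) ^ N • x = 0 := by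
  classical
  obtain ⟨c, hc⟩ : ∃ c, c = (decompose ℳ x).support.card := ⟨_, rfl⟩
  induction c using Nat.strong_induction_on generalizing x with
  | _ c ih =>
  by_cases hx0 : x = 0
  · exact ⟨0, by simp [hx0]⟩
  have hne : (decompose ℳ x).support.Nonempty := by
    rw [Finset.nonempty_iff_ne_empty, Ne, DFinsupp.support_eq_empty]
    exact fun h => hx0 ((decompose ℳ).injective (h.trans (decompose_zero ℳ).symm))
  obtain ⟨d, hd, hmax⟩ := Finset.exists_max_image (decompose ℳ x).support toLex hne
  have key : (decompose 𝒜 a e : A) • (decompose ℳ x d : M) = 0 := by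
    have h1 : (decompose ℳ (a • x) (e + d) : M) = 0 := by rw [hx]; simp
    rw [← sum_support_decompose 𝒜 a, Finset.sum_smul, decompose_sum, DFinsupp.finsetSum_apply,
      AddSubmonoidClass.coe_finsetSum] at h1
    rw [Finset.sum_eq_single e] at h1
    · rwa [decompose_smul_of_mem ℳ (decompose 𝒜 a e).2] at h1
    · intro e' he' hne'
      have hlt : toLex e' < toLex e := lt_of_le_of_ne (he e' (DFinsupp.mem_support_iff.1 he'))
        (fun h => hne' (toLex.injective h))
      -- For e' < e the matching index e - e' + d exceeds d, where x has no component.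
      have hed : e + d = e' + (e - e' + d) := by abel
      rw [hed, decompose_smul_of_mem ℳ (decompose 𝒜 a e').2]
      by_cases h0 : decompose ℳ x (e - e' + d) = 0
      · simp [h0]
      · have h2 := hmax _ (DFinsupp.mem_support_iff.2 h0)
        have h3 : toLex (e - e') + toLex d ≤ 0 + toLex d := by rw [zero_add]; exact h2
        have h4 : toLex e - toLex e' ≤ 0 := le_of_add_le_add_right h3
        exact absurd (sub_nonpos.1 h4) hlt.not_ge
    · intro he'
      rw [DFinsupp.notMem_support_iff.1 he']
      simp
  have hlt : (decompose ℳ ((decompose 𝒜 a e : A) • x)).support.card < c := by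
    rw [hc]
    -- Each component of the product in degree i comes from that of x in degree i - e, and the one
    -- in degree d contributes zero.
    refine lt_of_le_of_lt (Finset.card_le_card_of_injOn (t := (decompose ℳ x).support.erase d)
      (fun i => i - e) ?_ (fun i _ j _ h => sub_left_injective h)) (Finset.card_erase_lt_of_mem hd)
    intro i hi
    have hi' := DFinsupp.mem_support_iff.1 hi
    have hie : e + (i - e) = i := by abel
    have hs := decompose_smul_of_mem ℳ (decompose 𝒜 a e).2 x (i - e)
    rw [hie] at hs
    refine Finset.mem_coe.2 (Finset.mem_erase.2 ⟨fun h => hi' ?_, DFinsupp.mem_support_iff.2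
      fun h => hi' ?_⟩)
    · rw [show i - e = d from h, key] at hs
      exact Subtype.ext hs
    · rw [show decompose ℳ x (i - e) = 0 from h] at hs
      exact Subtype.ext (hs.trans (by simp))
  obtain ⟨N, hN⟩ := ih _ hlt ((decompose 𝒜 a e : A) • x)
    (by rw [smul_comm, hx, smul_zero]) rfl
  exact ⟨N + 1, by rw [pow_succ, mul_smul, hN]⟩

/-- For p = ann(x), a power of the top component of a kills x, so that component lies in the prime
p. Subtract it and induct on the number of components. -/
theorem decompose_mem_of_mem_associatedPrime [IsNoetherianRing A]
    (ℳ : ℤ × ℤ → AddSubgroup M) [Decomposition ℳ]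
    [SetLike.GradedSMul 𝒜 ℳ]
    {p : Ideal A}
    (hp : p ∈ associatedPrimes A M) {a : A} (ha : a ∈ p) (i : ℤ × ℤ) :
    (decompose 𝒜 a i : A) ∈ p := by
  classical
  obtain ⟨hprime, x, rfl⟩ := isAssociatedPrime_iff.1 hp
  obtain ⟨c, hc⟩ : ∃ c, c = (decompose 𝒜 a).support.card := ⟨_, rfl⟩
  induction c using Nat.strong_induction_on generalizing a with
  | _ c ih =>
  by_cases ha0 : a = 0
  · simp [ha0]
  have hne : (decompose 𝒜 a).support.Nonempty := by
    rw [Finset.nonempty_iff_ne_empty, Ne, DFinsupp.support_eq_empty]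
    exact fun h => ha0 ((decompose 𝒜).injective (h.trans (decompose_zero 𝒜).symm))
  obtain ⟨e, he, hmax⟩ := Finset.exists_max_image (decompose 𝒜 a).support toLex hne
  obtain ⟨N, hN⟩ := exists_top_component_pow_smul_eq_zero ℳ
    (fun e' he' => hmax e' (DFinsupp.mem_support_iff.2 he')) x
    (by simpa using Submodule.mem_colon_singleton.1 ha)
  have hep : (decompose 𝒜 a e : A) ∈ (⊥ : Submodule A M).colon {x} :=
    hprime.mem_of_pow_mem N (Submodule.mem_colon_singleton.2 (by simpa using hN))
  by_cases hie : i = e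
  · rwa [hie]
  have hdec : ∀ j, (decompose 𝒜 (a - decompose 𝒜 a e)) j =
      if j = e then 0 else decompose 𝒜 a j := by
    intro j
    rw [decompose_sub, decompose_coe, DirectSum.sub_apply]
    split_ifs with h
    · rw [h, of_eq_same, sub_self]
    · rw [of_eq_of_ne _ _ _ h, sub_zero]
  have hlt : (decompose 𝒜 (a - decompose 𝒜 a e)).support.card < c := by
    rw [hc]
    refine Finset.card_lt_card ((Finset.ssubset_iff_of_subset fun j hj => ?_).2 ⟨e, he, ?_⟩)
    · rw [DFinsupp.mem_support_iff, hdec] at hj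
      rw [DFinsupp.mem_support_iff]
      split_ifs at hj with h
      · exact absurd rfl hj
      · exact hj
    · rw [DFinsupp.notMem_support_iff, hdec, if_pos rfl]
  have := ih _ hlt (sub_mem ha hep) rfl
  rwa [hdec, if_neg hie] at this

theorem H0_isHomogeneous (ℳ : ℤ × ℤ → AddSubgroup M) [Decomposition ℳ]
    [SetLike.GradedSMul 𝒜 ℳ]
    {I : Ideal A} (hI : I.IsHomogeneous 𝒜) :
    (H0 I M).IsHomogeneous ℳ := by
  rintro d x ⟨k, hk⟩
  have hIk : (I ^ k).IsHomogeneous 𝒜 := by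
    clear hk
    induction k with
    | zero => rw [pow_zero, Ideal.one_eq_top]; exact Ideal.IsHomogeneous.top 𝒜
    | succ k ih => rw [pow_succ]; exact ih.mul hI
  refine ⟨k, fun a ha => ?_⟩
  classical
  rw [← sum_support_decompose 𝒜 a, Finset.sum_smul]
  refine Finset.sum_eq_zero fun e _ => ?_
  rw [← decompose_smul_of_mem ℳ (decompose 𝒜 a e).2, hk _ (hIk e ha)]
  simp

end Homogeneous

/-! ### H⁰_I(M) through primary decomposition, and its place in the filtration. -/

section PrimaryDecomposition

variable {K : Type u} [Field K] {m n : ℕ} {M : Type u} [AddCommGroup M] [Module (S K m n) M]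

theorem finite_B [Module.Finite (S K m n) M] (N : Submodule (S K m n) M) : (B N).Finite :=
  (associatedPrimes.finite (S K m n) M).subset fun _ h => h.1

theorem I_eq_prod [Module.Finite (S K m n) M] (N : Submodule (S K m n) M) :
    I N = ∏ p ∈ (finite_B N).toFinset, p :=
  finprod_mem_eq_finite_toFinset_prod _ (finite_B N)

theorem I_le_of_mem_B [Module.Finite (S K m n) M] {N : Submodule (S K m n) M}
    {p : Ideal (S K m n)} (hp : p ∈ B N) : I N ≤ p := by
  rw [I_eq_prod]
  exact Ideal.prod_le_inf.trans (Finset.inf_le (f := fun p => p) ((finite_B N).mem_toFinset.2 hp))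

theorem exists_mem_B_le_of_I_le [Module.Finite (S K m n) M] {N : Submodule (S K m n) M}
    {q : Ideal (S K m n)} (hq : q.IsPrime) (h : I N ≤ q) : ∃ p ∈ B N, p ≤ q := by
  rw [I_eq_prod] at h
  obtain ⟨p, hp, hpq⟩ := (Ideal.IsPrime.prod_le hq).1 h
  exact ⟨p, (finite_B N).mem_toFinset.1 hp, hpq⟩

theorem I_isHomogeneous [Module.Finite (S K m n) M] (ℳ : ℤ × ℤ → AddSubgroup M)
    [DirectSum.Decomposition ℳ] [SetLike.GradedSMul (grading K m n) ℳ]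
    [GradedRing (grading K m n)] (N : Submodule (S K m n) M) :
    (I N).IsHomogeneous (grading K m n) := by
  rw [I_eq_prod]
  refine Finset.prod_induction _ (fun J : Ideal (S K m n) => J.IsHomogeneous (grading K m n))
    (fun _ _ h h' => h.mul h') ?_ fun p hp i a ha => ?_
  · rw [Ideal.one_eq_top]
    exact Ideal.IsHomogeneous.top _
  · exact decompose_mem_of_mem_associatedPrime ℳ ((finite_B N).mem_toFinset.1 hp).1 ha i

variable {t : Finset (Submodule (S K m n) M)}

/-- For p_j ∈ B a power of I maps M into N_j, and the other N_j contain x already. One exponent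
serves all x, which is what puts a power of I inside the annihilator of H⁰_I(M). -/
theorem exists_pow_I_smul_eq_zero [Module.Finite (S K m n) M]
    (ht : (⊥ : Submodule (S K m n) M).IsMinimalPrimaryDecomposition t)
    (L : Submodule (S K m n) M) :
    ∃ k : ℕ, ∀ x ∈ ⨅ N ∈ t, ⨅ _ : (N.colon Set.univ).radical ∉ B L, N,
      ∀ a ∈ I L ^ k, a • x = 0 := by
  have h (N : Submodule (S K m n) M) : ∃ k : ℕ, (N.colon Set.univ).radical ∈ B L →
      I L ^ k ≤ N.colon Set.univ := by
    obtain ⟨k, hk⟩ := (N.colon Set.univ).exists_radical_pow_le_of_fg (IsNoetherian.noetherian _)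
    exact ⟨k, fun hB => (Ideal.pow_right_mono (I_le_of_mem_B hB) k).trans hk⟩
  choose k hk using h
  refine ⟨t.sup k, fun x hx a ha => ?_⟩
  rw [← Submodule.mem_bot (S K m n), ← ht.inf_eq, Submodule.mem_finsetInf]
  intro N hN
  by_cases hB : (N.colon Set.univ).radical ∈ B L
  · exact Submodule.mem_colon.1 (hk N hB (Ideal.pow_le_pow_right (Finset.le_sup hN) ha)) x trivial
  · refine N.smul_mem a ?_
    simp only [Submodule.mem_iInf] at hx
    exact hx N hN hB

theorem mem_B_of_le [Module.Finite (S K m n) M] {L : Submodule (S K m n) M}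
    {p q : Ideal (S K m n)} (hp : p ∈ B L) (hq : q ∈ associatedPrimes (S K m n) M) (h : p ≤ q) :
    q ∈ B L :=
  ⟨hq, (cd_quotient_anti hq.isPrime h).trans hp.2⟩

/-- If a power of I kills some x outside N_j, then I ⊆ p_j, so p_j contains a member of B and itself
belongs to B by `mem_B_of_le`. -/
theorem H0_I_eq_iInf [Module.Finite (S K m n) M]
    (ht : (⊥ : Submodule (S K m n) M).IsMinimalPrimaryDecomposition t)
    (L : Submodule (S K m n) M) :
    H0 (I L) M = ⨅ N ∈ t, ⨅ _ : (N.colon Set.univ).radical ∉ B L, N := by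
  refine le_antisymm ?_ fun x hx => ?_
  · rintro x ⟨k, hk⟩
    simp only [Submodule.mem_iInf]
    intro N hN hB
    by_contra hxN
    have hprime := (ht.primary hN).isPrime_radical_colon
    have hpow : I L ^ k ≤ (N.colon Set.univ).radical := fun a ha =>
      ((ht.primary hN).mem_or_mem (hk a ha ▸ N.zero_mem)).resolve_left hxN
    obtain ⟨p, hp, hpq⟩ := exists_mem_B_le_of_I_le hprime (hprime.le_of_pow_le hpow)
    exact hB (mem_B_of_le hp (ht.mem_associatedPrimes hN) hpq)
  · obtain ⟨k, hk⟩ := exists_pow_I_smul_eq_zero ht L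
    exact ⟨k, hk x hx⟩

theorem le_iInf_of_isMinimalPrimaryDecomposition [Module.Finite (S K m n) M]
    (ht : (⊥ : Submodule (S K m n) M).IsMinimalPrimaryDecomposition t)
    (L : Submodule (S K m n) M) :
    L ≤ ⨅ N ∈ t, ⨅ _ : (N.colon Set.univ).radical ∉ B L, N := by
  intro x hx
  simp only [Submodule.mem_iInf]
  intro N hN hB
  by_contra hxN
  refine hB ⟨ht.mem_associatedPrimes hN,
    cd_quotient_prime_le (ht.primary hN).isPrime_radical_colon fun a ha => ?_⟩
  have hax : a • x = 0 := congrArg Subtype.val (Module.mem_annihilator.1 ha ⟨x, hx⟩)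
  exact ((ht.primary hN).mem_or_mem (hax ▸ N.zero_mem)).resolve_left hxN

theorem cd_H0_I_le [Module.Finite (S K m n) M]
    (ht : (⊥ : Submodule (S K m n) M).IsMinimalPrimaryDecomposition t)
    (L : Submodule (S K m n) M) : cd (Q K m n) (H0 (I L) M) ≤ cd (Q K m n) L := by
  refine cd_le_of_forall_prime fun q hq hle => ?_
  obtain ⟨k, hk⟩ := exists_pow_I_smul_eq_zero ht L
  have hpow : I L ^ k ≤ q := fun a ha => hle (Module.mem_annihilator.2 fun x =>
    Subtype.ext (hk x (H0_I_eq_iInf ht L ▸ x.2) a ha))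
  obtain ⟨p, hp, hpq⟩ := exists_mem_B_le_of_I_le hq (hq.le_of_pow_le hpow)
  exact (cd_quotient_anti hq hpq).trans hp.2

end PrimaryDecomposition

theorem IsDimensionFiltration.H0_I_le {K : Type u} [Field K] {m n : ℕ} {M : Type u}
    [AddCommGroup M] [Module (S K m n) M] [Module.Finite (S K m n) M]
    {ℳ : ℤ × ℤ → AddSubgroup M} [DirectSum.Decomposition ℳ]
    [SetLike.GradedSMul (grading K m n) ℳ] {r : ℕ} {D : Fin (r + 1) → Submodule (S K m n) M}
    (hD : IsDimensionFiltration ℳ D) {t : Finset (Submodule (S K m n) M)}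
    (ht : (⊥ : Submodule (S K m n) M).IsMinimalPrimaryDecomposition t) (i : Fin (r + 1)) :
    H0 (I (D i)) M ≤ D i := by
  let : GradedRing (grading K m n) := MvPolynomial.weightedGradedAlgebra _ _
  have hhom : (H0 (I (D i)) M).IsHomogeneous ℳ := H0_isHomogeneous ℳ (I_isHomogeneous ℳ (D i))
  suffices h : ∀ j, i ≤ j → H0 (I (D i)) M ≤ D j from h i le_rfl
  intro j
  induction j using Fin.reverseInduction with
  | last => exact fun _ => hD.last_eq ▸ le_top
  | cast j ih =>
    intro hij
    -- The maximality of D_j applies because cd(Q, H⁰) ≤ cd(Q, D_i) ≤ cd(Q, D_j) < cd(Q, D_{j+1}).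
    refine (hD.largest j).2 ⟨hhom, ih (hij.trans j.castSucc_le_succ), ?_⟩
    exact ((cd_H0_I_le ht (D i)).trans (cd_mono (hD.strictMono.monotone hij))).trans_lt
      (hD.largest j).1.2.2

end BigradedCd
end

theorem proposition1p4 {K : Type u} [Field K] {m n : ℕ}
    {M : Type u} [AddCommGroup M] [Module (BigradedCd.S K m n) M]
    [Module.Finite (BigradedCd.S K m n) M]
    (ℳ : ℤ × ℤ → AddSubgroup M) [DirectSum.Decomposition ℳ]
    [SetLike.GradedSMul (BigradedCd.grading K m n) ℳ]
    {r : ℕ} (D : Fin (r + 1) → Submodule (BigradedCd.S K m n) M)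
    (hD : BigradedCd.IsDimensionFiltration ℳ D)
    (t : Finset (Submodule (BigradedCd.S K m n) M))
    (ht : (⊥ : Submodule (BigradedCd.S K m n) M).IsMinimalPrimaryDecomposition t)
    (i : Fin r) :
    D i.castSucc = BigradedCd.H0 (BigradedCd.I (D i.castSucc)) M ∧
    BigradedCd.H0 (BigradedCd.I (D i.castSucc)) M =
      ⨅ N ∈ t, ⨅ _ : (N.colon Set.univ).radical ∉ BigradedCd.B (D i.castSucc), N := by
  have h := BigradedCd.H0_I_eq_iInf ht (D i.castSucc)
  refine ⟨le_antisymm ?_ (hD.H0_I_le ht i.castSucc), h⟩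
  rw [h]
  exact BigradedCd.le_iInf_of_isMinimalPrimaryDecomposition ht (D i.castSucc)
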